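/- Let $F$ be a field containing a primitive $5$th root of unity $\rho$ (so $\operatorname{char} F\neq 5$), and let $A$ be a cyclic algebra of degree $5$ over $F$, that is, a central simple $F$-algebra of dimension $25$ of the form $F[a,b : a^5=\alpha,\ b^5=\beta,\ ba=\rho ab]$ with $\alpha,\beta\in F^\times$. An element $x\in A$ is called $5$-central if $x\notin F$, $x^5\in F$ and $x^k\notin F$ for $1\le k\le 4$. Let $\mathcal X$ be the set of invertible $5$-central elements of $A$ (if $A$ is a division algebra, these are all the $5$-central elements). For $x,z\in\mathcal X$ there is a unique decomposition $z=\sum_{i\in\mathbb Z/5\mathbb Z} z_i$ with $z_i x=\rho^i x z_i$ for all $i$; put $$l(x,z)=\{i\in\mathbb Z/5\mathbb Z : z_i\neq 0\},\qquad w(x,z)=\#\, l(x,z).$$ A Rost chain connecting $x$ and $z$ is a finite sequence $x=x_0,x_1,\dots,x_n=z$ of elements of $\mathcal X$ with $w(x_k,x_{k+1})=1$ for all $0\le k<n$; equivalently, for every $k$ there is an integer $d_k$ with $x_kx_{k+1}=\rho^{d_k}x_{k+1}x_k$. Theorem. If $x,z\in\mathcal X$ satisfy $w(x,z)=2$ and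 $0\notin l(z,x)$, then there is a Rost chain connecting $x$ and $z$. -/

import Mathlib

namespace RostChains

/-- `x` is `d`-central in the `F`-algebra `A`: it is noncentral, `x ^ d` is central, and no
`x ^ k` with `1 ≤ k ≤ d - 1` is central. -/
def IsDCentral (F : Type*) {A : Type*} [Field F] [Ring A] [Algebra F A] (d : ℕ) (x : A) : Prop :=
  x ∉ Subalgebra.center F A ∧ x ^ d ∈ Subalgebra.center F A ∧
    ∀ k : ℕ, 1 ≤ k → k < d → x ^ k ∉ Subalgebra.center F A

/-- The vertices of the graph: the invertible `d`-central elements, i.e. those by which one can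
conjugate. In a division algebra every `d`-central element is invertible. -/
def IsVertex (F : Type*) {A : Type*} [Field F] [Ring A] [Algebra F A] (d : ℕ) (x : A) : Prop :=
  IsDCentral F d x ∧ IsUnit x

/-- `A` is a cyclic algebra of degree `p` over `F`, where `ρ` is a primitive `p`-th root of unity
of `F`: a central simple `F`-algebra of degree `p` of the symbol form
`F[a, b : a ^ p = α, b ^ p = β, b a = ρ a b]` with `α, β ∈ Fˣ`. It may be split. -/
def IsCyclicAlgebra {F : Type*} [Field F] (p : ℕ) (ρ : F) (A : Type*) [Ring A] [Algebra F A] :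
    Prop :=
  Algebra.IsCentral F A ∧ IsSimpleRing A ∧ Module.finrank F A = p ^ 2 ∧
    ∃ (α β : F) (a b : A), α ≠ 0 ∧ β ≠ 0 ∧ a ^ p = algebraMap F A α ∧
      b ^ p = algebraMap F A β ∧ b * a = ρ • (a * b) ∧ Algebra.adjoin F {a, b} = ⊤

/-- `c` is the decomposition `z = ∑ i, z_i`, indexed by `ℤ/pℤ`, with `z_i x = ρ ^ i x z_i`. -/
def IsDecomposition {F A : Type*} [Field F] [Ring A] [Algebra F A] (p : ℕ) [NeZero p] (ρ : F)
    (x z : A) (c : ZMod p → A) : Prop :=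
  (∀ i : ZMod p, c i * x = ρ ^ i.val • (x * c i)) ∧ ∑ i : ZMod p, c i = z

/-- The label `l(x, z) = {i ∈ ℤ/pℤ : z_i ≠ 0}`, where `z = ∑ i, z_i` and
`z_i x = ρ ^ i x z_i`. The decomposition is unique for the elements that matter, see
`existsUnique_isDecomposition` below. -/
def label {F A : Type*} [Field F] [Ring A] [Algebra F A] (p : ℕ) [NeZero p] (ρ : F)
    (x z : A) : Set (ZMod p) :=
  {i | ∃ c : ZMod p → A, IsDecomposition p ρ x z c ∧ c i ≠ 0}

/-- The weight `w(x, z)`: the number of elements of the label `l(x, z)`. -/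
noncomputable def weight {F A : Type*} [Field F] [Ring A] [Algebra F A] (p : ℕ) [NeZero p] (ρ : F)
    (x z : A) : ℕ :=
  (label p ρ x z).ncard

/-- `x` and `z` are connected by a Rost chain: a finite chain `x = c 0, c 1, …, c n = z` of
vertices in which every edge `(c k, c (k + 1))` has weight `1`. -/
def RostConnected {F A : Type*} [Field F] [Ring A] [Algebra F A] (p : ℕ) [NeZero p] (ρ : F)
    (x z : A) : Prop :=
  ∃ (n : ℕ) (c : ℕ → A), c 0 = x ∧ c n = z ∧ (∀ k ≤ n, IsVertex F p (c k)) ∧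
    ∀ k < n, weight p ρ (c k) (c (k + 1)) = 1

theorem sum_pow_eq_ite {F : Type*} [Field F] (p : ℕ) {ζ : F} (h : ζ ^ p = 1) [Decidable (ζ = 1)] :
    ∑ j ∈ Finset.range p, ζ ^ j = if ζ = 1 then (p : F) else 0 := by
  split_ifs with h1
  · simp [h1]
  · have := mul_geom_sum ζ p
    rw [h, sub_self] at this
    exact (mul_eq_zero.mp this).resolve_left (sub_ne_zero.mpr h1)

/-- The label is well defined: for a vertex `x`, each `z` has exactly one decomposition. -/
theorem existsUnique_isDecomposition {F A : Type*} [Field F] [Ring A] [Algebra F A] (p : ℕ)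
    [NeZero p] {ρ : F} (hρ : IsPrimitiveRoot ρ p) {x : A} (hx : IsVertex F p x) (z : A) :
    ∃! c : ZMod p → A, IsDecomposition p ρ x z c := by
  classical
  obtain ⟨⟨-, hc, -⟩, u, rfl⟩ := hx
  have hp : (p : F) ≠ 0 := hρ.neZero'.out
  have hu (w : A) : (u : A) ^ p * w * ((u⁻¹ : Aˣ) : A) ^ p = w := by
    rw [← (Subalgebra.mem_center_iff.mp hc w), mul_assoc, ← Units.val_pow_eq_pow_val,
      ← Units.val_pow_eq_pow_val, inv_pow, Units.mul_inv, mul_one]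
  have hρ0 : ρ ≠ 0 := hρ.ne_zero (NeZero.ne p)
  refine ⟨fun i => (p : F)⁻¹ • ∑ j ∈ Finset.range p,
    (ρ ^ i.val) ^ j • ((u : A) ^ j * z * ((u⁻¹ : Aˣ) : A) ^ j), ⟨fun i => ?_, ?_⟩, ?_⟩
  · set t := ρ ^ i.val with ht
    have htp : t ^ p = 1 := by rw [ht, ← pow_mul, mul_comm, pow_mul, hρ.pow_eq_one, one_pow]
    set f : ℕ → A := fun j => t ^ j • ((u : A) ^ j * z * ((u⁻¹ : Aˣ) : A) ^ j) with hf
    have hstep (j : ℕ) : t • ((u : A) * f j) = f (j + 1) * u := by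
      simp only [hf, mul_smul_comm, smul_mul_assoc, smul_smul]
      rw [pow_succ', pow_succ' (u : A), pow_succ ((u⁻¹ : Aˣ) : A)]
      congr 1
      simp [mul_assoc]
    have hfp : f p = f 0 := by simp only [hf, htp, hu]; simp
    have hs : ∑ j ∈ Finset.range p, f (j + 1) = ∑ j ∈ Finset.range p, f j := by
      have h1 := Finset.sum_range_succ f p
      have h2 := Finset.sum_range_succ' f p
      rw [h1, hfp] at h2
      exact (add_right_cancel h2).symm
    simp only [smul_mul_assoc, mul_smul_comm]
    rw [smul_comm t]
    congr 1
    rw [Finset.mul_sum, Finset.smul_sum, Finset.sum_congr rfl fun j _ => hstep j,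
      ← Finset.sum_mul, hs]
  · have key (j : ℕ) (hj : j < p) :
        ∑ i : ZMod p, (ρ ^ i.val) ^ j = if j = 0 then (p : F) else 0 := by
      have h1 : ∑ i : ZMod p, (ρ ^ i.val) ^ j = ∑ i ∈ Finset.range p, (ρ ^ j) ^ i := by
        refine Finset.sum_nbij' (fun i => i.val) (fun i => (i : ZMod p)) ?_ ?_ ?_ ?_ ?_
        · intro i _; simpa using ZMod.val_lt i
        · intro i _; simp
        · intro i _; simp
        · intro i hi; exact ZMod.val_cast_of_lt (by simpa using hi)
        · intro i _; rw [← pow_mul, ← pow_mul, mul_comm]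
      rw [h1, sum_pow_eq_ite p (by rw [← pow_mul, mul_comm, pow_mul, hρ.pow_eq_one, one_pow])]
      refine if_congr ⟨fun h => ?_, fun h => by simp [h]⟩ rfl rfl
      by_contra h0
      exact hρ.pow_ne_one_of_pos_of_lt h0 hj h
    rw [← Finset.smul_sum, Finset.sum_comm]
    simp only [← Finset.sum_smul]
    rw [Finset.sum_congr rfl fun j hj => by rw [key j (by simpa using hj)],
      Finset.sum_eq_single_of_mem 0 (by simpa using NeZero.pos p) (by intro j _ h; simp [h])]
    simp [smul_smul, hp]
  · rintro d ⟨hd, rfl⟩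
    funext i
    have hconj (k : ZMod p) (j : ℕ) :
        (ρ ^ i.val) ^ j • ((u : A) ^ j * d k * ((u⁻¹ : Aˣ) : A) ^ j)
          = (ρ ^ i.val * (ρ ^ k.val)⁻¹) ^ j • d k := by
      have h1 : (u : A) * d k * ((u⁻¹ : Aˣ) : A) = (ρ ^ k.val)⁻¹ • d k := by
        rw [Units.mul_inv_eq_iff_eq_mul, smul_mul_assoc, hd k, smul_smul,
          inv_mul_cancel₀ (pow_ne_zero _ hρ0), one_smul]
      rw [mul_pow, ← smul_smul]
      congr 1
      induction j with
      | zero => simp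
      | succ j ih =>
        rw [pow_succ (u : A), pow_succ' ((u⁻¹ : Aˣ) : A)]
        calc (u : A) ^ j * u * d k * (((u⁻¹ : Aˣ) : A) * ((u⁻¹ : Aˣ) : A) ^ j)
            = (u : A) ^ j * (u * d k * ((u⁻¹ : Aˣ) : A)) * ((u⁻¹ : Aˣ) : A) ^ j := by
              simp only [mul_assoc]
          _ = _ := by rw [h1, mul_smul_comm, smul_mul_assoc, ih, smul_smul, pow_succ']
    simp only [Finset.mul_sum, Finset.sum_mul, Finset.smul_sum, hconj]
    rw [Finset.sum_comm]
    have hsum (k : ZMod p) :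
        ∑ j ∈ Finset.range p, (p : F)⁻¹ • (ρ ^ i.val * (ρ ^ k.val)⁻¹) ^ j • d k
          = if k = i then d k else 0 := by
      rw [← Finset.smul_sum, ← Finset.sum_smul, sum_pow_eq_ite p]
      · have : ρ ^ i.val * (ρ ^ k.val)⁻¹ = 1 ↔ k = i := by
          rw [mul_inv_eq_one₀ (pow_ne_zero _ hρ0)]
          refine ⟨fun h => ?_, fun h => by rw [h]⟩
          exact (ZMod.val_injective p (hρ.pow_inj (ZMod.val_lt i) (ZMod.val_lt k) h)).symm
        simp only [this]
        split_ifs <;> simp [smul_smul, hp]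
      · have hone (k : ZMod p) : (ρ ^ k.val) ^ p = 1 := by
          rw [← pow_mul, mul_comm, pow_mul, hρ.pow_eq_one, one_pow]
        rw [mul_pow, inv_pow, hone, hone, inv_one, one_mul]
    simp [hsum]

end RostChains

/-! By Wedderburn, `A` is either the split algebra of endomorphisms of a 5-dimensional space or a
division algebra.

Division case. Write `z = y + t` with `y`, `t` homogeneous for the grading by `x`. If `t y = ω y t`
with `ω ^ 5 = 1`, then `y⁻¹ t` commutes up to fifth roots of unity with both `x` and `z`, and `x,
y⁻¹ t, z` is a chain (`reflTransGen_adj_add`). After swapping `y` and `t` and changing `ρ`, one has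
`y x = ρ x y` and `t x = ρ ^ k x t` with `k` in `{0, 2, 4}`. If `k = 0`, centrality of `z ^ 5` gives
`y t ^ 5 = t ^ 5 y`, so `t` and `y t y⁻¹`, which commute, differ by a root of unity. If `k` is `2`
or `4`, then `t = f(x) y ^ k` with `deg f ≤ 4`. The homogeneous components of `z ^ 5` in nonzero
degrees vanish. The condition `0 ∉ l(z, x)` gives `∑ z ^ j x z ^ (4 - j) = 0`, so the components of
this sum vanish too. Four of these equations force `f` to be a monomial (`exists_mul_eq_smul`),
which yields the relation between `t` and `y`.

Split case. Any two vertices are connected: each is linked to a dilation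
(`exists_reflTransGen_dilation`), and any two dilations commute with a common third one
(`reflTransGen_adj_dilation`). -/

namespace RostChains

/-! ### Adjacency, the grading by a vertex, and sums of words -/

section Basics

variable {F A : Type*} [Field F] [Ring A] [Algebra F A]

/-- `a` and `b` commute up to a fifth root of unity of `F`. -/
def Edge (F : Type*) {A : Type*} [Field F] [Ring A] [Algebra F A] (a b : A) : Prop :=
  ∃ ω : F, ω ^ 5 = 1 ∧ b * a = ω • (a * b)

/-- Adjacency of `5`-central units. -/
def Adj (F : Type*) {A : Type*} [Field F] [Ring A] [Algebra F A] (a b : A) : Prop :=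
  IsVertex F 5 a ∧ IsVertex F 5 b ∧ Edge F a b

theorem Edge.symm {a b : A} (h : Edge F a b) : Edge F b a := by
  obtain ⟨ω, hω, h⟩ := h
  have h0 : ω ≠ 0 := by rintro rfl; simp at hω
  exact ⟨ω⁻¹, by rw [inv_pow, hω, inv_one], by rw [h, smul_smul, inv_mul_cancel₀ h0, one_smul]⟩

theorem Edge.of_commute {a b : A} (h : Commute a b) : Edge F a b :=
  ⟨1, one_pow _, by rw [one_smul, h.eq]⟩

theorem Adj.symm {a b : A} (h : Adj F a b) : Adj F b a :=
  ⟨h.2.1, h.1, h.2.2.symm⟩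

theorem exists_zmod_pow {ρ : F} (hρ : IsPrimitiveRoot ρ 5) {ω : F} (hω : ω ^ 5 = 1) :
    ∃ i : ZMod 5, ω = ρ ^ i.val := by
  obtain ⟨m, hm, rfl⟩ := hρ.eq_pow_of_pow_eq_one hω
  exact ⟨m, by rw [ZMod.val_cast_of_lt hm]⟩

theorem label_eq {ρ : F} (hρ : IsPrimitiveRoot ρ 5) {x z : A} (hx : IsVertex F 5 x)
    {c : ZMod 5 → A} (hc : IsDecomposition 5 ρ x z c) : label 5 ρ x z = {i | c i ≠ 0} := by
  ext i
  constructor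
  · rintro ⟨d, hd, hi⟩
    rwa [(existsUnique_isDecomposition 5 hρ hx z).unique hd hc] at hi
  · exact fun hi => ⟨c, hc, hi⟩

theorem weight_eq_one {ρ : F} (hρ : IsPrimitiveRoot ρ 5) {a b : A} (ha : IsVertex F 5 a)
    (hb : b ≠ 0) (h : Edge F a b) : weight 5 ρ a b = 1 := by
  obtain ⟨ω, hω, h⟩ := h
  obtain ⟨i, rfl⟩ := exists_zmod_pow hρ hω
  have hd : IsDecomposition 5 ρ a b (Pi.single i b) := by
    refine ⟨fun j => ?_, by simp⟩
    by_cases hj : j = i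
    · subst hj; simpa using h
    · simp [hj]
  rw [weight, label_eq hρ ha hd, Set.ncard_eq_one]
  refine ⟨i, ?_⟩
  ext j
  by_cases hj : j = i
  · subst hj; simpa using hb
  · simp [hj]

theorem rostConnected_of_reflTransGen [Nontrivial A] {ρ : F} (hρ : IsPrimitiveRoot ρ 5) {x z : A}
    (hx : IsVertex F 5 x) (h : Relation.ReflTransGen (Adj F) x z) : RostConnected 5 ρ x z := by
  induction h with
  | refl => exact ⟨0, fun _ => x, rfl, rfl, fun _ _ => hx, by simp⟩
  | @tail b d _ hbd ih =>
    obtain ⟨n, c, h0, hn, hv, hw⟩ := ih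
    refine ⟨n + 1, fun k => if k ≤ n then c k else d, by simp [h0], by simp, ?_, ?_⟩
    · intro k _
      dsimp only
      split_ifs with hk
      · exact hv k hk
      · exact hbd.2.1
    · intro k hk
      rcases Nat.lt_succ_iff_lt_or_eq.mp hk with hk | rfl
      · simpa [hk.le, Nat.succ_le_of_lt hk] using hw k hk
      · simpa [hn] using weight_eq_one hρ hbd.1 hbd.2.1.2.ne_zero hbd.2.2

theorem mem_center_of_mul_mem_center {w c : A} (hc : c ∈ Subalgebra.center F A) (hu : IsUnit c)
    (h : w * c ∈ Subalgebra.center F A) : w ∈ Subalgebra.center F A := by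
  rw [Subalgebra.mem_center_iff] at *
  intro b
  refine hu.mul_left_injective ?_
  simp only
  rw [mul_assoc, h b, mul_assoc, ← hc b, mul_assoc]

/-- Since 5 is prime, centrality of `w ^ k` with `0 < k < 5` together with that of `w ^ 5` would
make `w` central. The cases use `w * w ^ 4 = w ^ 5`, `w * w ^ 5 = (w ^ 3) ^ 2` and `w * w ^ 4 = w ^
5` again. -/
theorem isVertex_of_pow {w : A} (hu : IsUnit w) (h5 : w ^ 5 ∈ Subalgebra.center F A)
    (h1 : w ∉ Subalgebra.center F A) : IsVertex F 5 w := by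
  refine ⟨⟨h1, h5, fun k hk hk5 hc => h1 ?_⟩, hu⟩
  interval_cases k
  · simpa using hc
  · refine mem_center_of_mul_mem_center (c := w ^ 4) ?_ (hu.pow 4) (by rwa [← pow_succ'])
    simpa [← pow_mul] using pow_mem hc 2
  · refine mem_center_of_mul_mem_center h5 (hu.pow 5) ?_
    simpa [← pow_mul, ← pow_succ'] using pow_mem hc 2
  · exact mem_center_of_mul_mem_center hc (hu.pow 4) (by rwa [← pow_succ'])

theorem IsVertex.map {B : Type*} [Ring B] [Algebra F B] (e : A ≃ₐ[F] B) {x : A}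
    (hx : IsVertex F 5 x) : IsVertex F 5 (e x) := by
  have hc (a : A) : e a ∈ Subalgebra.center F B ↔ a ∈ Subalgebra.center F A := by
    simp only [Subalgebra.mem_center_iff]
    refine ⟨fun h b => e.injective (by simpa using h (e b)), fun h b => ?_⟩
    obtain ⟨b, rfl⟩ := e.surjective b
    rw [← map_mul, h b, map_mul]
  obtain ⟨⟨h1, h2, -⟩, h4⟩ := hx
  exact isVertex_of_pow (h4.map e) (by rwa [← map_pow, hc]) (by rwa [hc])

theorem Adj.map {B : Type*} [Ring B] [Algebra F B] (e : A ≃ₐ[F] B) {x z : A}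
    (h : Adj F x z) : Adj F (e x) (e z) := by
  obtain ⟨hx, hz, ω, hω, h⟩ := h
  exact ⟨hx.map e, hz.map e, ω, hω, by rw [← map_mul, h, map_smul, map_mul]⟩

/-- The elements `a` with `a x = ρ ^ i x a`. -/
def graded (ρ : F) (x : A) (i : ZMod 5) : Submodule F A where
  carrier := {a | a * x = ρ ^ i.val • (x * a)}
  add_mem' {a b} ha hb := by
    simp only [Set.mem_ofPred_eq] at *
    rw [add_mul, ha, hb, mul_add, smul_add]
  zero_mem' := by simp
  smul_mem' c a ha := by
    simp only [Set.mem_ofPred_eq] at *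
    rw [smul_mul_assoc, ha, mul_smul_comm, smul_comm]

theorem mem_graded {ρ : F} {x a : A} {i : ZMod 5} :
    a ∈ graded ρ x i ↔ a * x = ρ ^ i.val • (x * a) := Iff.rfl

theorem pow_val_natCast {ρ : F} (hρ : ρ ^ 5 = 1) (n : ℕ) : ρ ^ (n : ZMod 5).val = ρ ^ n := by
  rw [ZMod.val_natCast, ← pow_eq_pow_mod n hρ]

theorem mul_mem_graded {ρ : F} (hρ : ρ ^ 5 = 1) {x a b : A} {i j : ZMod 5}
    (ha : a ∈ graded ρ x i) (hb : b ∈ graded ρ x j) : a * b ∈ graded ρ x (i + j) := by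
  rw [mem_graded] at *
  have : ρ ^ (i + j).val = ρ ^ i.val * ρ ^ j.val := by
    rw [ZMod.val_add, ← pow_eq_pow_mod _ hρ, pow_add]
  rw [mul_assoc, hb, mul_smul_comm, ← mul_assoc, ha, smul_mul_assoc, smul_smul, this, mul_assoc,
    mul_comm]

theorem mul_mem_graded' {ρ : F} (hρ : ρ ^ 5 = 1) {x a b : A} {i j k : ZMod 5}
    (ha : a ∈ graded ρ x i) (hb : b ∈ graded ρ x j) (hk : i + j = k) : a * b ∈ graded ρ x k :=
  hk ▸ mul_mem_graded hρ ha hb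

theorem one_mem_graded {ρ : F} {x : A} : (1 : A) ∈ graded ρ x 0 := by
  simp [mem_graded]

theorem self_mem_graded {ρ : F} {x : A} : x ∈ graded ρ x 0 := by
  simp [mem_graded]

theorem eq_zero_of_sum_graded_eq_zero {ρ : F} (hρ : IsPrimitiveRoot ρ 5) {x : A}
    (hx : IsVertex F 5 x) {c : ZMod 5 → A} (hc : ∀ i, c i ∈ graded ρ x i)
    (h : ∑ i, c i = 0) (i : ZMod 5) : c i = 0 := by
  have h0 : IsDecomposition 5 ρ x (0 : A) (fun _ => 0) := ⟨by simp, by simp⟩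
  exact congrFun ((existsUnique_isDecomposition 5 hρ hx 0).unique ⟨hc, h⟩ h0) i

/-- The sum of all products of `a` factors `y` and `b` factors `t`. -/
def words (y t : A) : ℕ → ℕ → A
  | 0, 0 => 1
  | a + 1, 0 => y * words y t a 0
  | 0, b + 1 => t * words y t 0 b
  | a + 1, b + 1 => y * words y t a (b + 1) + t * words y t (a + 1) b

/-- The sum of all products of `a` factors `y`, `b` factors `t` and one factor `x`. -/
def markedWords (y t x : A) : ℕ → ℕ → A
  | 0, 0 => x
  | a + 1, 0 => y * markedWords y t x a 0 + x * words y t (a + 1) 0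
  | 0, b + 1 => t * markedWords y t x 0 b + x * words y t 0 (b + 1)
  | a + 1, b + 1 => y * markedWords y t x a (b + 1) + t * markedWords y t x (a + 1) b +
      x * words y t (a + 1) (b + 1)

theorem words_mem_graded {ρ : F} (hρ : ρ ^ 5 = 1) {x y t : A} {i j : ZMod 5}
    (hy : y ∈ graded ρ x i) (ht : t ∈ graded ρ x j) (a b : ℕ) :
    words y t a b ∈ graded ρ x (a * i + b * j) := by
  induction a, b using words.induct with
  | case1 => simpa [words] using one_mem_graded
  | case2 a ih =>
    rw [words]
    refine mul_mem_graded' hρ hy ih ?_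
    push_cast; ring
  | case3 b ih =>
    rw [words]
    refine mul_mem_graded' hρ ht ih ?_
    push_cast; ring
  | case4 a b ih₁ ih₂ =>
    rw [words]
    refine add_mem (mul_mem_graded' hρ hy ih₁ ?_) (mul_mem_graded' hρ ht ih₂ ?_) <;>
      (push_cast; ring)

theorem markedWords_mem_graded {ρ : F} (hρ : ρ ^ 5 = 1) {x y t : A} {i j : ZMod 5}
    (hy : y ∈ graded ρ x i) (ht : t ∈ graded ρ x j) (a b : ℕ) :
    markedWords y t x a b ∈ graded ρ x (a * i + b * j) := by
  have hw (a b : ℕ) : x * words y t a b ∈ graded ρ x (a * i + b * j) :=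
    mul_mem_graded' hρ self_mem_graded (words_mem_graded hρ hy ht a b) (zero_add _)
  induction a, b using markedWords.induct with
  | case1 => simpa [markedWords] using self_mem_graded
  | case2 a ih =>
    rw [markedWords]
    refine add_mem (mul_mem_graded' hρ hy ih ?_) (hw _ _)
    push_cast; ring
  | case3 b ih =>
    rw [markedWords]
    refine add_mem (mul_mem_graded' hρ ht ih ?_) (hw _ _)
    push_cast; ring
  | case4 a b ih₁ ih₂ =>
    rw [markedWords]
    refine add_mem (add_mem (mul_mem_graded' hρ hy ih₁ ?_) (mul_mem_graded' hρ ht ih₂ ?_))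
      (hw _ _) <;> (push_cast; ring)

theorem add_pow_five (y t : A) : (y + t) ^ 5 = y ^ 5 + t ^ 5 +
    words y t 4 1 + words y t 3 2 + words y t 2 3 + words y t 1 4 := by
  simp only [words, pow_succ', pow_zero, mul_add, add_mul, mul_one]
  abel

/-- Every word with four letters from `y`, `t` and one `x` occurs once on the left; the right side
groups them by degree in `y` and `t`. -/
theorem sum_pow_mul_pow_eq (y t x : A) :
    ∑ j ∈ Finset.range 5, (y + t) ^ j * x * (y + t) ^ (4 - j) =
    markedWords y t x 4 0 + markedWords y t x 3 1 + markedWords y t x 2 2 +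
      markedWords y t x 1 3 + markedWords y t x 0 4 := by
  simp only [Finset.sum_range_succ, Finset.sum_range_zero, markedWords, words, pow_succ', pow_zero,
    mul_add, add_mul, mul_one, Nat.sub_self, Nat.reduceSub, zero_add, one_mul, mul_assoc]
  abel

end Basics

/-! ### Word sums as polynomial identities at a primitive fifth root of unity -/

section WordPolynomials

open Polynomial

variable {F : Type*} [Field F]

/-- The substitution `X ↦ r X`. -/
noncomputable def scaleX (r : F) : F[X] →ₐ[F] F[X] := aeval (C r * X)

@[simp] theorem scaleX_X (r : F) : scaleX r X = C r * X := by simp [scaleX]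

@[simp] theorem scaleX_C (r a : F) : scaleX r (C a) = C a := by simp [scaleX]

/-- The coefficient of `y ^ (a + k b)` in `words y (f y ^ k) a b`, where `y X = r X y`. -/
noncomputable def wordPoly (r : F) (k : ℕ) (f : F[X]) : ℕ → ℕ → F[X]
  | 0, 0 => 1
  | a + 1, 0 => scaleX r (wordPoly r k f a 0)
  | 0, b + 1 => f * scaleX (r ^ k) (wordPoly r k f 0 b)
  | a + 1, b + 1 => scaleX r (wordPoly r k f a (b + 1)) +
      f * scaleX (r ^ k) (wordPoly r k f (a + 1) b)

/-- The coefficient of `y ^ (a + k b)` in `markedWords y (f y ^ k) X a b`, where `y X = r X y`. -/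
noncomputable def markedWordPoly (r : F) (k : ℕ) (f : F[X]) : ℕ → ℕ → F[X]
  | 0, 0 => X
  | a + 1, 0 => scaleX r (markedWordPoly r k f a 0) + X * wordPoly r k f (a + 1) 0
  | 0, b + 1 => f * scaleX (r ^ k) (markedWordPoly r k f 0 b) + X * wordPoly r k f 0 (b + 1)
  | a + 1, b + 1 => scaleX r (markedWordPoly r k f a (b + 1)) +
      f * scaleX (r ^ k) (markedWordPoly r k f (a + 1) b) + X * wordPoly r k f (a + 1) (b + 1)

theorem sum_C_pow_eq_zero {r : F} (hr : IsPrimitiveRoot r 5) :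
    (C r : F[X]) ^ 4 + C r ^ 3 + C r ^ 2 + C r + 1 = 0 := by
  have h := hr.geom_sum_eq_zero (by norm_num)
  simp only [Finset.sum_range_succ, Finset.sum_range_zero] at h
  have := congrArg (C : F → F[X]) h
  simp only [map_add, map_pow, map_zero] at this
  linear_combination this

/-- The sum is `∑ f(r ^ i X)` over `i < 5`, which kills every coefficient but the constant one. -/
theorem wordPoly_four_one {r : F} (hr : IsPrimitiveRoot r 5) {k : ℕ} (hk : k = 2 ∨ k = 4)
    (c₀ c₁ c₂ c₃ c₄ : F) :
    wordPoly r k (C c₀ + C c₁ * X + C c₂ * X ^ 2 + C c₃ * X ^ 3 + C c₄ * X ^ 4) 4 1 =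
      5 * C c₀ := by
  have h := sum_C_pow_eq_zero hr
  rcases hk with rfl | rfl <;>
  · simp only [wordPoly, map_add, map_mul, map_pow, scaleX_X, scaleX_C, map_one]
    grind

theorem five_ne_zero_of_isPrimitiveRoot {r : F} (hr : IsPrimitiveRoot r 5) : (5 : F) ≠ 0 := by
  have : NeZero ((5 : ℕ) : F) := hr.neZero'
  exact_mod_cast this.out

theorem sum_pow_eq_zero {r : F} (hr : IsPrimitiveRoot r 5) :
    r ^ 4 + r ^ 3 + r ^ 2 + r + 1 = 0 := by
  have h := hr.geom_sum_eq_zero (by norm_num)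
  simp only [Finset.sum_range_succ, Finset.sum_range_zero] at h
  linear_combination h

/-- The coefficient of `c_m X ^ (m + 1)` is a polynomial in `r` that vanishes at a primitive fifth
root of unity unless `m = 4`. There it is 5 times a cyclotomic unit, hence nonzero. No reduction of
`X ^ 5` is involved. -/
theorem exists_markedWordPoly_three_one {r : F} (hr : IsPrimitiveRoot r 5) {k : ℕ}
    (hk : k = 2 ∨ k = 4) : ∃ γ : F, γ ≠ 0 ∧ ∀ c₁ c₂ c₃ c₄ : F,
    markedWordPoly r k (C c₁ * X + C c₂ * X ^ 2 + C c₃ * X ^ 3 + C c₄ * X ^ 4) 3 1 =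
      C (γ * c₄) * X ^ 5 := by
  have h := sum_C_pow_eq_zero hr
  have h' := sum_pow_eq_zero hr
  have h5 := five_ne_zero_of_isPrimitiveRoot hr
  rcases hk with rfl | rfl
  · refine ⟨-5 * r, by grind, fun c₁ c₂ c₃ c₄ => ?_⟩
    simp only [markedWordPoly, wordPoly, map_add, map_mul, map_pow, scaleX_X, scaleX_C, map_one,
      map_neg, map_ofNat]
    grind
  · refine ⟨-5 * (r * (1 + r + r ^ 2)), by grind, fun c₁ c₂ c₃ c₄ => ?_⟩
    simp only [markedWordPoly, wordPoly, map_add, map_mul, map_pow, scaleX_X, scaleX_C, map_one,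
      map_neg, map_ofNat]
    grind

/-- Only the products `c_m c_n` with `m + n = 5` survive. -/
theorem exists_wordPoly_three_two {r : F} (hr : IsPrimitiveRoot r 5) {k : ℕ}
    (hk : k = 2 ∨ k = 4) : ∃ γ : F, γ ≠ 0 ∧ ∀ c₁ c₂ c₃ : F,
    wordPoly r k (C c₁ * X + C c₂ * X ^ 2 + C c₃ * X ^ 3) 3 2 = C (γ * (c₂ * c₃)) * X ^ 5 := by
  have h := sum_C_pow_eq_zero hr
  have h' := sum_pow_eq_zero hr
  have h5 := five_ne_zero_of_isPrimitiveRoot hr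
  rcases hk with rfl | rfl
  · refine ⟨5 * (r + r ^ 4), by grind, fun c₁ c₂ c₃ => ?_⟩
    simp only [wordPoly, map_add, map_mul, map_pow, scaleX_X, scaleX_C, map_one, map_ofNat]
    grind
  · refine ⟨5 * (1 + r ^ 2 + r ^ 3), by grind, fun c₁ c₂ c₃ => ?_⟩
    simp only [wordPoly, map_add, map_mul, map_pow, scaleX_X, scaleX_C, map_one, map_ofNat]
    grind

/-- Only the products `c_m c_n` with `m + n` equal to 4 or 5 survive. The value of `ε` is
immaterial, since `c₂ * c₃` will already be known to vanish. -/
theorem exists_markedWordPoly_two_two {r : F} (hr : IsPrimitiveRoot r 5) {k : ℕ}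
    (hk : k = 2 ∨ k = 4) : ∃ γ δ ε : F, γ ≠ 0 ∧ δ ≠ 0 ∧ ∀ c₁ c₂ c₃ : F,
    markedWordPoly r k (C c₁ * X + C c₂ * X ^ 2 + C c₃ * X ^ 3) 2 2 =
      C (γ * (c₁ * c₃) + δ * c₂ ^ 2) * X ^ 5 + C (ε * (c₂ * c₃)) * X ^ 6 := by
  have h := sum_C_pow_eq_zero hr
  have h' := sum_pow_eq_zero hr
  have h5 := five_ne_zero_of_isPrimitiveRoot hr
  rcases hk with rfl | rfl
  · refine ⟨5 * r, -5 * (1 + r ^ 2), -5 * r ^ 3, by grind, by grind, fun c₁ c₂ c₃ => ?_⟩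
    simp only [markedWordPoly, wordPoly, map_add, map_mul, map_pow, scaleX_X, scaleX_C, map_one,
      map_neg, map_ofNat]
    grind
  · refine ⟨5 * (1 + r ^ 4), 5 * r ^ 2, 5 * (1 + r ^ 2 + r ^ 3), by grind, by grind,
      fun c₁ c₂ c₃ => ?_⟩
    simp only [markedWordPoly, wordPoly, map_add, map_mul, map_pow, scaleX_X, scaleX_C, map_one,
      map_ofNat]
    grind

end WordPolynomials

/-! ### Evaluating the word polynomials in the algebra -/

section Evaluation

open Polynomial

variable {F A : Type*} [Field F] [Ring A] [Algebra F A]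

theorem mul_pow_of_mul_eq_smul {r : F} {x y : A} (h : y * x = r • (x * y)) (n : ℕ) :
    y * x ^ n = r ^ n • (x ^ n * y) := by
  induction n with
  | zero => simp
  | succ n ih =>
    rw [pow_succ, ← mul_assoc, ih, smul_mul_assoc, mul_assoc, h, mul_smul_comm, smul_smul,
      pow_succ, mul_assoc]

theorem pow_mul_of_mul_eq_smul {r : F} {x y : A} (h : y * x = r • (x * y)) (n : ℕ) :
    y ^ n * x = r ^ n • (x * y ^ n) := by
  induction n with
  | zero => simp
  | succ n ih =>
    rw [pow_succ, mul_assoc, h, mul_smul_comm, ← mul_assoc, ih, smul_mul_assoc, smul_smul,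
      mul_comm, pow_succ, mul_assoc]

theorem mul_aeval_eq {r : F} {x b : A} (h : b * x = r • (x * b)) (P : F[X]) :
    b * aeval x P = aeval x (scaleX r P) * b := by
  induction P using Polynomial.induction_on' with
  | add p q hp hq => simp only [map_add, mul_add, add_mul, hp, hq]
  | monomial n a =>
    rw [← C_mul_X_pow_eq_monomial]
    simp only [map_mul, map_pow, scaleX_C, scaleX_X, aeval_C, aeval_X]
    rw [← mul_assoc, ← Algebra.commutes a b, mul_assoc, mul_pow_of_mul_eq_smul h,
      (show Commute _ _ from Algebra.commutes r x).mul_pow, ← map_pow (algebraMap F A),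
      ← Algebra.smul_def (r ^ n), mul_assoc, smul_mul_assoc]

theorem mul_aeval_mul_pow {r : F} {x y : A} (h : y * x = r • (x * y)) (P : F[X]) (m : ℕ) :
    y * (aeval x P * y ^ m) = aeval x (scaleX r P) * y ^ (m + 1) := by
  rw [← mul_assoc, mul_aeval_eq h, mul_assoc, pow_succ']

theorem aeval_mul_pow_mul_aeval_mul_pow {r : F} {x y : A} (h : y * x = r • (x * y))
    (f P : F[X]) (k m : ℕ) :
    aeval x f * y ^ k * (aeval x P * y ^ m) = aeval x (f * scaleX (r ^ k) P) * y ^ (m + k) := by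
  rw [mul_assoc, ← mul_assoc (y ^ k), mul_aeval_eq (pow_mul_of_mul_eq_smul h k), map_mul,
    add_comm, pow_add]
  simp only [mul_assoc]

theorem words_eq {r : F} {x y : A} (h : y * x = r • (x * y)) (f : F[X]) (k a b : ℕ) :
    words y (aeval x f * y ^ k) a b = aeval x (wordPoly r k f a b) * y ^ (a + k * b) := by
  induction a, b using words.induct with
  | case1 => simp [words, wordPoly]
  | case2 a ih => rw [words, wordPoly, ih, mul_aeval_mul_pow h]; congr 2
  | case3 b ih =>
    rw [words, wordPoly, ih, aeval_mul_pow_mul_aeval_mul_pow h]; congr 2; simp only [Nat.succ_eq_add_one]; ring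
  | case4 a b ih₁ ih₂ =>
    rw [words, wordPoly, ih₁, ih₂, mul_aeval_mul_pow h, aeval_mul_pow_mul_aeval_mul_pow h,
      map_add, add_mul]
    congr 3 <;> (simp only [Nat.succ_eq_add_one]; ring)

theorem markedWords_eq {r : F} {x y : A} (h : y * x = r • (x * y)) (f : F[X]) (k a b : ℕ) :
    markedWords y (aeval x f * y ^ k) x a b =
      aeval x (markedWordPoly r k f a b) * y ^ (a + k * b) := by
  have hw (a b : ℕ) : x * words y (aeval x f * y ^ k) a b =
      aeval x (X * wordPoly r k f a b) * y ^ (a + k * b) := by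
    rw [words_eq h, map_mul, aeval_X, mul_assoc]
  induction a, b using markedWords.induct with
  | case1 => simp [markedWords, markedWordPoly]
  | case2 a ih =>
    rw [markedWords, markedWordPoly, ih, hw, mul_aeval_mul_pow h, map_add, add_mul]
    congr 3
  | case3 b ih =>
    rw [markedWords, markedWordPoly, ih, hw, aeval_mul_pow_mul_aeval_mul_pow h, map_add, add_mul]
    congr 3; simp only [Nat.succ_eq_add_one]; ring
  | case4 a b ih₁ ih₂ =>
    rw [markedWords, markedWordPoly, ih₁, ih₂, hw, mul_aeval_mul_pow h,
      aeval_mul_pow_mul_aeval_mul_pow h, map_add, map_add, add_mul, add_mul]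
    congr 4 <;> (simp only [Nat.succ_eq_add_one]; ring)

end Evaluation

/-! ### Division algebras -/

section Division

open Polynomial

variable {F D : Type*} [Field F] [DivisionRing D] [Algebra F D]

/-- Powers of `x` are eigenvectors of conjugation by `y`. -/
theorem linearIndependent_pow {ρ : F} (hρ : IsPrimitiveRoot ρ 5) {x y : D} (hx : x ≠ 0)
    (hy : y ≠ 0) (h : y * x = ρ • (x * y)) :
    LinearIndependent F (fun n : Fin 5 => x ^ (n : ℕ)) := by
  let f : Module.End F D := LinearMap.mulLeft F y * LinearMap.mulRight F y⁻¹
  refine f.eigenvectors_linearIndependent' (fun n : Fin 5 => ρ ^ (n : ℕ)) ?_ _ fun n =>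
    ⟨?_, pow_ne_zero _ hx⟩
  · intro m n hmn
    exact Fin.ext (hρ.pow_inj m.2 n.2 hmn)
  · rw [Module.End.mem_eigenspace_iff]
    simp only [f, Module.End.mul_apply, LinearMap.mulLeft_apply, LinearMap.mulRight_apply]
    rw [← mul_assoc, mul_pow_of_mul_eq_smul h, smul_mul_assoc, mul_inv_cancel_right₀ hy]

theorem pow_mem_graded {ρ : F} (hρ : ρ ^ 5 = 1) {x y : D} (h : y * x = ρ • (x * y)) (n : ℕ) :
    y ^ n ∈ graded ρ x n := by
  rw [mem_graded, pow_val_natCast hρ, pow_mul_of_mul_eq_smul h]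

/-- The five translates of the centralizer of `x` by powers of `y` lie in different degrees, so
their sum is direct inside a space of dimension 25. -/
theorem finrank_graded_zero_le {ρ : F} (hρ : IsPrimitiveRoot ρ 5) (hD : Module.finrank F D = 25)
    {x y : D} (hx : IsVertex F 5 x) (hy : y ≠ 0) (h : y * x = ρ • (x * y)) :
    Module.finrank F (graded ρ x 0) ≤ 5 := by
  have : Module.Finite F D := Module.finite_of_finrank_pos (by omega)
  let f : (ZMod 5 → graded ρ x 0) →ₗ[F] D :=
    ∑ i : ZMod 5, LinearMap.mulRight F (y ^ i.val) ∘ₗ (graded ρ x 0).subtype ∘ₗ LinearMap.proj i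
  have hf : Function.Injective f := by
    rw [injective_iff_map_eq_zero]
    intro c hc
    have hc' : ∑ i : ZMod 5, (c i : D) * y ^ i.val = 0 := by simpa [f] using hc
    funext i
    have := eq_zero_of_sum_graded_eq_zero hρ hx (c := fun i => (c i : D) * y ^ i.val)
      (fun i => mul_mem_graded' hρ.pow_eq_one (c i).2 (pow_mem_graded hρ.pow_eq_one h i.val)
        (by simp)) hc' i
    simpa [hy] using this
  have := LinearMap.finrank_le_finrank_of_injective hf
  rw [Module.finrank_pi_fintype, hD] at this
  simp [ZMod.card] at this
  omega

theorem exists_eq_sum_pow {ρ : F} (hρ : IsPrimitiveRoot ρ 5) (hD : Module.finrank F D = 25)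
    {x y : D} (hx : IsVertex F 5 x) (hy : y ≠ 0) (h : y * x = ρ • (x * y)) {a : D}
    (ha : a * x = x * a) : ∃ c : Fin 5 → F, ∑ n, c n • x ^ (n : ℕ) = a := by
  have : Module.Finite F D := Module.finite_of_finrank_pos (by omega)
  have hli := linearIndependent_pow hρ hx.2.ne_zero hy h
  have hle : Submodule.span F (Set.range fun n : Fin 5 => x ^ (n : ℕ)) ≤ graded ρ x 0 := by
    rw [Submodule.span_le]
    rintro _ ⟨n, rfl⟩
    simp [mem_graded, ← pow_succ, ← pow_succ']
  have heq := Submodule.eq_of_le_of_finrank_le hle (by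
    rw [finrank_span_eq_card hli, Fintype.card_fin]
    exact finrank_graded_zero_le hρ hD hx hy h)
  have : a ∈ Submodule.span F (Set.range fun n : Fin 5 => x ^ (n : ℕ)) := by
    rw [heq]; simpa [mem_graded] using ha
  exact (Submodule.mem_span_range_iff_exists_fun F).mp this

/-- An element commuting with both generators of a degree `5` cyclic algebra is a scalar. -/
theorem exists_eq_algebraMap {ρ : F} (hρ : IsPrimitiveRoot ρ 5) (hD : Module.finrank F D = 25)
    {x y : D} (hx : IsVertex F 5 x) (hy : y ≠ 0) (h : y * x = ρ • (x * y)) {a : D}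
    (hax : a * x = x * a) (hay : a * y = y * a) : ∃ α : F, a = algebraMap F D α := by
  obtain ⟨c, rfl⟩ := exists_eq_sum_pow hρ hD hx hy h hax
  have hli := linearIndependent_pow hρ hx.2.ne_zero hy h
  -- Conjugation by `y` multiplies the coefficient of `x ^ n` by `ρ ^ n`, so only `n = 0` can
  -- survive.
  have h0 : ∑ n : Fin 5, ((1 - ρ ^ (n : ℕ)) * c n) • x ^ (n : ℕ) = 0 := by
    apply mul_right_cancel₀ hy
    have : ∑ n : Fin 5, (c n • x ^ (n : ℕ) * y - y * c n • x ^ (n : ℕ)) = 0 := by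
      rw [Finset.sum_sub_distrib, ← Finset.sum_mul, ← Finset.mul_sum, hay, sub_self]
    rw [zero_mul, Finset.sum_mul, ← this]
    refine Finset.sum_congr rfl fun n _ => ?_
    rw [mul_smul_comm, mul_pow_of_mul_eq_smul h, smul_mul_assoc, smul_mul_assoc, smul_smul,
      sub_mul, one_mul, sub_smul, mul_comm (c n)]
  have hc := Fintype.linearIndependent_iff.mp hli _ h0
  refine ⟨c 0, ?_⟩
  rw [Finset.sum_eq_single_of_mem 0 (Finset.mem_univ _)]
  · simp [Algebra.algebraMap_eq_smul_one]
  · intro n _ hn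
    have hn' : ρ ^ (n : ℕ) ≠ 1 :=
      hρ.pow_ne_one_of_pos_of_lt (Fin.val_ne_zero_iff.mpr hn) n.2
    have : c n = 0 := (mul_eq_zero.mp (hc n)).resolve_left (sub_ne_zero.mpr hn'.symm)
    rw [this, zero_smul]

theorem isVertex_of_mul_eq_smul {ρ : F} (hρ : IsPrimitiveRoot ρ 5) (hD : Module.finrank F D = 25)
    {x y : D} (hx : IsVertex F 5 x) (hy : y ≠ 0) (h : y * x = ρ • (x * y)) : IsVertex F 5 y := by
  refine isVertex_of_pow hy.isUnit ?_ fun hc => ?_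
  · obtain ⟨β, hβ⟩ := exists_eq_algebraMap hρ hD hx hy h (a := y ^ 5)
      (by rw [pow_mul_of_mul_eq_smul h, hρ.pow_eq_one, one_smul]) (by rw [← pow_succ, ← pow_succ'])
    rw [hβ]
    exact Subalgebra.algebraMap_mem _ _
  · rw [Subalgebra.mem_center_iff] at hc
    have h1 : (1 - ρ) • (x * y) = 0 := by rw [sub_smul, ← h, hc x, one_smul, sub_self]
    rw [smul_eq_zero, sub_eq_zero] at h1
    rcases h1 with h1 | h1
    · exact hρ.ne_one (by norm_num) h1.symm
    · exact mul_ne_zero hx.2.ne_zero hy h1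

/-- `X ^ 5 - 1` splits over `F`, so one of its linear factors must vanish at `g`, as there are no
zero divisors. -/
theorem exists_eq_algebraMap_of_pow_eq_one {ρ : F} (hρ : IsPrimitiveRoot ρ 5) {g : D}
    (hg : g ^ 5 = 1) : ∃ ω : F, ω ^ 5 = 1 ∧ g = algebraMap F D ω := by
  have h := congrArg (aeval g) (X_pow_sub_one_eq_prod (by norm_num : 0 < 5) hρ)
  simp only [map_sub, map_pow, aeval_X, map_one, hg, sub_self] at h
  rw [← Finset.prod_map_toList, map_list_prod, eq_comm, List.prod_eq_zero_iff] at h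
  simp only [List.map_map, List.mem_map, Finset.mem_toList] at h
  obtain ⟨ω, hω, h⟩ := h
  rw [mem_nthRootsFinset (by norm_num)] at hω
  exact ⟨ω, hω, by simpa [sub_eq_zero] using h⟩

theorem isPrimitiveRoot_of_pow_eq_one {ω : F} (h : ω ^ 5 = 1) (h1 : ω ≠ 1) :
    IsPrimitiveRoot ω 5 := by
  have : Fact (Nat.Prime 5) := ⟨by norm_num⟩
  rw [IsPrimitiveRoot.iff_orderOf]
  exact orderOf_eq_prime h h1

/-- If the two components of `z` commute up to a root of unity, then their quotient connects
`x` with `z`. -/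
theorem reflTransGen_adj_add (hD : Module.finrank F D = 25) {x y t : D} (hx : IsVertex F 5 x)
    (hz : IsVertex F 5 (y + t)) (hy : y ≠ 0) (ht : t ≠ 0) {a b ω : F} (ha : a ^ 5 = 1)
    (hb : b ^ 5 = 1) (hab : a ≠ b) (hω : ω ^ 5 = 1) (hyx : y * x = a • (x * y))
    (htx : t * x = b • (x * t)) (hty : t * y = ω • (y * t)) :
    Relation.ReflTransGen (Adj F) x (y + t) := by
  have ha0 : a ≠ 0 := by rintro rfl; simp at ha
  have hyx' : y⁻¹ * x = a⁻¹ • (x * y⁻¹) := by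
    apply mul_left_cancel₀ hy
    apply mul_right_cancel₀ hy
    rw [mul_inv_cancel_left₀ hy, mul_smul_comm, smul_mul_assoc, ← mul_assoc,
      inv_mul_cancel_right₀ hy, hyx, smul_smul, inv_mul_cancel₀ ha0, one_smul]
  have hty' : y⁻¹ * t * y = ω • t := by
    rw [mul_assoc, hty, mul_smul_comm, inv_mul_cancel_left₀ hy]
  have hs : y⁻¹ * t * x = (b * a⁻¹) • (x * (y⁻¹ * t)) := by
    rw [mul_assoc, htx, mul_smul_comm, ← mul_assoc, hyx', smul_mul_assoc, smul_smul, mul_assoc]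
  have hba : (b * a⁻¹) ^ 5 = 1 := by rw [mul_pow, inv_pow, ha, hb, inv_one, one_mul]
  have hba1 : b * a⁻¹ ≠ 1 := fun h => hab (mul_inv_eq_one₀ ha0 |>.mp h).symm
  have hsv : IsVertex F 5 (y⁻¹ * t) :=
    isVertex_of_mul_eq_smul (isPrimitiveRoot_of_pow_eq_one hba hba1) hD hx
      (mul_ne_zero (inv_ne_zero hy) ht) hs
  -- The quotient `y⁻¹ t` commutes with `y` and with `t` up to the same factor `ω`, hence also with
  -- their sum.
  have hsz : y⁻¹ * t * (y + t) = ω • ((y + t) * (y⁻¹ * t)) := by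
    have h1 : t * (y⁻¹ * t) * y = ω • (t * t) := by rw [mul_assoc, hty', mul_smul_comm]
    have h2 : y⁻¹ * t * t * y = (ω * ω) • (t * t) := by
      rw [mul_assoc, hty, mul_smul_comm, ← mul_assoc, hty', smul_mul_assoc, smul_smul]
    have h3 : y⁻¹ * t * t = ω • (t * (y⁻¹ * t)) := by
      apply mul_right_cancel₀ hy
      rw [h2, smul_mul_assoc, h1, smul_smul]
    rw [mul_add, add_mul, hty', h3, smul_add, mul_inv_cancel_left₀ hy]
  have hzs : Edge F (y + t) (y⁻¹ * t) := ⟨ω, hω, hsz⟩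
  exact .tail (.single ⟨hx, hsv, b * a⁻¹, hba, hs⟩) ⟨hsv, hz, hzs.symm⟩

theorem eq_zero_of_sum_graded_affine {A : Type*} [Ring A] [Algebra F A] {ρ : F}
    (hρ : IsPrimitiveRoot ρ 5) {x : A} (hx : IsVertex F 5 x) {c : ZMod 5 → A} {u v : ZMod 5}
    (hu : u ≠ 0) (hc : ∀ a, c a ∈ graded ρ x (u * a + v)) (h : ∑ a, c a = 0) (a : ZMod 5) :
    c a = 0 := by
  have : Fact (Nat.Prime 5) := ⟨by norm_num⟩
  let e : ZMod 5 ≃ ZMod 5 := (Equiv.mulLeft₀ u hu).trans (Equiv.addRight v)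
  have he (a : ZMod 5) : e a = u * a + v := rfl
  have := eq_zero_of_sum_graded_eq_zero hρ hx (c := fun n => c (e.symm n))
    (fun n => by simpa [← he] using hc (e.symm n)) (by rw [e.symm.sum_comp, h]) (e a)
  simpa using this

theorem words_eq_zero {A : Type*} [Ring A] [Algebra F A] {ρ : F} (hρ : IsPrimitiveRoot ρ 5)
    {x y t : A} (hx : IsVertex F 5 x) (hz : (y + t) ^ 5 ∈ Subalgebra.center F A) {i j : ZMod 5}
    (hij : i ≠ j) (hy : y ∈ graded ρ x i) (ht : t ∈ graded ρ x j) :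
    words y t 4 1 = 0 ∧ words y t 3 2 = 0 ∧ words y t 2 3 = 0 ∧ words y t 1 4 = 0 := by
  have hw := words_mem_graded hρ.pow_eq_one hy ht
  have h0 : y ^ 5 + t ^ 5 - (y + t) ^ 5 ∈ graded ρ x 0 := by
    refine sub_mem (add_mem ?_ ?_) ?_
    · have h5 : y ^ 5 = words y t 5 0 := by simp [words, pow_succ']
      rw [h5]
      convert hw 5 0 using 2; clear * - i j; revert i j; decide
    · have h5 : t ^ 5 = words y t 0 5 := by simp [words, pow_succ']
      rw [h5]
      convert hw 0 5 using 2; clear * - i j; revert i j; decide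
    · simpa [mem_graded] using (Subalgebra.mem_center_iff.mp hz x).symm
  -- Entry `a` collects the words with `a` letters `y` modulo 5, of degree `(i - j) a`; thus `y ^ 5`
  -- and `t ^ 5` share entry 0 with `z ^ 5`.
  let c : ZMod 5 → A :=
    ![y ^ 5 + t ^ 5 - (y + t) ^ 5, words y t 1 4, words y t 2 3, words y t 3 2, words y t 4 1]
  have hc : ∀ a, c a ∈ graded ρ x ((i - j) * a + 0) := by
    intro a
    fin_cases a
    · convert h0 using 2 <;> [(clear * - i j; revert i j; decide); rfl]
    · convert hw 1 4 using 2 <;> [(clear * - i j; revert i j; decide); rfl]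
    · convert hw 2 3 using 2 <;> [(clear * - i j; revert i j; decide); rfl]
    · convert hw 3 2 using 2 <;> [(clear * - i j; revert i j; decide); rfl]
    · convert hw 4 1 using 2 <;> [(clear * - i j; revert i j; decide); rfl]
  have hs : ∑ a, c a = 0 := by
    refine (Fin.sum_univ_five c).trans ?_
    change y ^ 5 + t ^ 5 - (y + t) ^ 5 + words y t 1 4 + words y t 2 3 + words y t 3 2 +
      words y t 4 1 = 0
    rw [add_pow_five]
    abel
  have := eq_zero_of_sum_graded_affine hρ hx (sub_ne_zero.mpr hij) hc hs
  exact ⟨this 4, this 3, this 2, this 1⟩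

theorem markedWords_eq_zero {A : Type*} [Ring A] [Algebra F A] {ρ : F} (hρ : IsPrimitiveRoot ρ 5)
    {x y t : A} (hx : IsVertex F 5 x)
    (hz : ∑ j ∈ Finset.range 5, (y + t) ^ j * x * (y + t) ^ (4 - j) = 0) {i j : ZMod 5}
    (hij : i ≠ j) (hy : y ∈ graded ρ x i) (ht : t ∈ graded ρ x j) :
    markedWords y t x 3 1 = 0 ∧ markedWords y t x 2 2 = 0 := by
  have hw := markedWords_mem_graded hρ.pow_eq_one hy ht
  let c : ZMod 5 → A := ![markedWords y t x 0 4, markedWords y t x 1 3, markedWords y t x 2 2,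
    markedWords y t x 3 1, markedWords y t x 4 0]
  have hc : ∀ a, c a ∈ graded ρ x ((i - j) * a + 4 * j) := by
    intro a
    fin_cases a
    · convert hw 0 4 using 2 <;> [(clear * - i j; revert i j; decide); rfl]
    · convert hw 1 3 using 2 <;> [(clear * - i j; revert i j; decide); rfl]
    · convert hw 2 2 using 2 <;> [(clear * - i j; revert i j; decide); rfl]
    · convert hw 3 1 using 2 <;> [(clear * - i j; revert i j; decide); rfl]
    · convert hw 4 0 using 2 <;> [(clear * - i j; revert i j; decide); rfl]
  have hs : ∑ a, c a = 0 := by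
    refine (Fin.sum_univ_five c).trans ?_
    change markedWords y t x 0 4 + markedWords y t x 1 3 + markedWords y t x 2 2 +
      markedWords y t x 3 1 + markedWords y t x 4 0 = 0
    rw [sum_pow_mul_pow_eq] at hz
    rw [← hz]
    abel
  have := eq_zero_of_sum_graded_affine hρ hx (sub_ne_zero.mpr hij) hc hs
  exact ⟨this 3, this 2⟩

/-- On the component of `x` of degree `i` relative to `z`, the sum acts as a multiple of the
geometric sum of `ρ ^ i`, which is zero for `i ≠ 0`; the component of degree 0 is absent. -/
theorem sum_pow_mul_pow_eq_zero {A : Type*} [Ring A] [Algebra F A] {ρ : F}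
    (hρ : IsPrimitiveRoot ρ 5) {x z : A} (hz : IsVertex F 5 z)
    (h0 : (0 : ZMod 5) ∉ label 5 ρ z x) :
    ∑ j ∈ Finset.range 5, z ^ j * x * z ^ (4 - j) = 0 := by
  obtain ⟨c, hc, -⟩ := existsUnique_isDecomposition 5 hρ hz x
  rw [label_eq hρ hz hc, Set.mem_ofPred_eq, not_not] at h0
  have key (i : ZMod 5) : ∑ j ∈ Finset.range 5, z ^ j * c i * z ^ (4 - j) = 0 := by
    by_cases hi : i = 0
    · simp [hi, h0]
    have hcz (m : ℕ) := mul_pow_of_mul_eq_smul (hc.1 i) m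
    have hprim : IsPrimitiveRoot (ρ ^ i.val) 5 := by
      refine isPrimitiveRoot_of_pow_eq_one ?_ ?_
      · rw [← pow_mul, mul_comm, pow_mul, hρ.pow_eq_one, one_pow]
      · exact hρ.pow_ne_one_of_pos_of_lt (by simpa using hi) (ZMod.val_lt i)
    have : ∀ j ∈ Finset.range 5,
        z ^ j * c i * z ^ (4 - j) = (ρ ^ i.val) ^ (4 - j) • (z ^ 4 * c i) := by
      intro j hj
      rw [mul_assoc, hcz, mul_smul_comm, ← mul_assoc, ← pow_add]
      congr 3
      have := Finset.mem_range.mp hj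
      omega
    rw [Finset.sum_congr rfl this, ← Finset.sum_smul]
    have hs : ∑ j ∈ Finset.range 5, (ρ ^ i.val) ^ (4 - j) = 0 :=
      (Finset.sum_range_reflect (fun j => (ρ ^ i.val) ^ j) 5).trans
        (hprim.geom_sum_eq_zero (by norm_num))
    rw [hs, zero_smul]
  rw [← hc.2]
  simp only [Finset.mul_sum, Finset.sum_mul]
  rw [Finset.sum_comm]
  exact Finset.sum_eq_zero fun i _ => key i

theorem exists_mul_eq_smul_of_commute {ρ : F} (hρ : IsPrimitiveRoot ρ 5)
    (hD : Module.finrank F D = 25) {x y t : D} (hx : IsVertex F 5 x)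
    (hz : (y + t) ^ 5 ∈ Subalgebra.center F D) (hy : y ≠ 0) (ht : t ≠ 0)
    (hyx : y * x = ρ • (x * y)) (htx : t * x = x * t) :
    ∃ ω : F, ω ^ 5 = 1 ∧ t * y = ω • (y * t) := by
  obtain ⟨h1, h2, h3, h4⟩ := words_eq_zero hρ hx hz (i := 1) (j := 0) (by decide)
    (by simpa [mem_graded, show (1 : ZMod 5).val = 1 from rfl] using hyx) (by simpa [mem_graded] using htx)
  have hty : y * t ^ 5 = t ^ 5 * y := by
    have := Subalgebra.mem_center_iff.mp hz y
    rw [add_pow_five, h1, h2, h3, h4] at this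
    simpa [mul_add, add_mul, ← pow_succ, ← pow_succ'] using this
  set u := y * t * y⁻¹ with hu
  have huy : u * y = y * t := inv_mul_cancel_right₀ hy _
  have hux : u * x = x * u := by
    have h0 : ρ ≠ 0 := hρ.ne_zero (by norm_num)
    apply mul_right_cancel₀ hy
    have : ρ • (u * x * y) = ρ • (x * u * y) := by
      rw [mul_assoc, ← mul_smul_comm, ← hyx, ← mul_assoc, huy, mul_assoc, htx, ← mul_assoc, hyx,
        smul_mul_assoc, mul_assoc, mul_assoc x u, huy]
    exact smul_right_injective D h0 this
  -- Both `t` and its conjugate `u` centralize `x`, and this centralizer consists of polynomials in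
  -- `x`.
  have hut : Commute t u := by
    obtain ⟨c, rfl⟩ := exists_eq_sum_pow hρ hD hx hy hyx htx
    refine Commute.sum_left _ _ _ fun n _ => ?_
    exact ((show Commute x u from hux.symm).pow_left _).smul_left _
  have hu5 : u ^ 5 = t ^ 5 := by
    have h : y * t ^ 5 = u ^ 5 * y := SemiconjBy.pow_right (show y * t = u * y from huy.symm) 5
    exact mul_right_cancel₀ hy (by rw [← h, hty])
  obtain ⟨ω, hω, h⟩ := exists_eq_algebraMap_of_pow_eq_one hρ (g := t⁻¹ * u) (by
    rw [hut.inv_left₀.mul_pow, hu5, inv_pow, inv_mul_cancel₀ (pow_ne_zero _ ht)])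
  have h0 : ω ≠ 0 := by rintro rfl; simp at hω
  refine ⟨ω⁻¹, by rw [inv_pow, hω, inv_one], ?_⟩
  rw [eq_inv_smul_iff₀ h0, ← huy, ← mul_inv_cancel_left₀ ht u, h, ← Algebra.commutes, mul_assoc,
    Algebra.smul_def]

theorem exists_mul_eq_smul_monomial {ρ : F} (hρ : ρ ^ 5 = 1) {x y : D}
    (hyx : y * x = ρ • (x * y)) (c : F) (n k : ℕ) :
    ∃ ω : F, ω ^ 5 = 1 ∧ c • x ^ n * y ^ k * y = ω • (y * (c • x ^ n * y ^ k)) := by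
  have h0 : ρ ≠ 0 := by rintro rfl; simp at hρ
  refine ⟨(ρ ^ n)⁻¹, by rw [inv_pow, ← pow_mul, mul_comm, pow_mul, hρ, one_pow, inv_one], ?_⟩
  rw [eq_inv_smul_iff₀ (pow_ne_zero _ h0), ← mul_assoc y, mul_smul_comm,
    mul_pow_of_mul_eq_smul hyx]
  simp only [smul_mul_assoc, mul_assoc, ← pow_succ, ← pow_succ']
  rw [smul_comm]

theorem aeval_C_mul_X_pow_mul_eq_zero {x w : D} (hx : x ≠ 0) (hw : w ≠ 0) {γ : F} {n : ℕ}
    (h : aeval x (C γ * X ^ n) * w = 0) : γ = 0 := by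
  simpa [hx, hw] using h

theorem exists_mul_eq_smul {ρ : F} (hρ : IsPrimitiveRoot ρ 5)
    (hD : Module.finrank F D = 25) {x y t : D} (hx : IsVertex F 5 x)
    (hz : (y + t) ^ 5 ∈ Subalgebra.center F D)
    (hQ : ∑ j ∈ Finset.range 5, (y + t) ^ j * x * (y + t) ^ (4 - j) = 0) (hy : y ≠ 0) {k : ℕ}
    (hk : k = 2 ∨ k = 4) (hyx : y * x = ρ • (x * y)) (htx : t * x = ρ ^ k • (x * t)) :
    ∃ ω : F, ω ^ 5 = 1 ∧ t * y = ω • (y * t) := by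
  have hx0 := hx.2.ne_zero
  have hyk (m : ℕ) : y ^ m ≠ 0 := pow_ne_zero m hy
  have hk1 : (1 : ZMod 5) ≠ k := by rcases hk with rfl | rfl <;> decide
  have hy1 : y ∈ graded ρ x 1 := by simpa [mem_graded, show (1 : ZMod 5).val = 1 from rfl] using hyx
  have htk : t ∈ graded ρ x k := by rw [mem_graded, pow_val_natCast hρ.pow_eq_one, htx]
  obtain ⟨h41, h32, -, -⟩ := words_eq_zero hρ hx hz hk1 hy1 htk
  obtain ⟨h31, h22⟩ := markedWords_eq_zero hρ hx hQ hk1 hy1 htk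
  have hρk : ρ ^ k ≠ 0 := pow_ne_zero _ (hρ.ne_zero (by norm_num))
  -- `t` and `y ^ k` have the same degree, so their quotient is a polynomial `f` in `x`.
  have hfx : t * (y ^ k)⁻¹ * x = x * (t * (y ^ k)⁻¹) := by
    apply mul_right_cancel₀ (hyk k)
    have : ρ ^ k • (t * (y ^ k)⁻¹ * x * y ^ k) = ρ ^ k • (x * (t * (y ^ k)⁻¹) * y ^ k) := by
      rw [mul_assoc, ← mul_smul_comm, ← pow_mul_of_mul_eq_smul hyx, ← mul_assoc,
        inv_mul_cancel_right₀ (hyk k), htx, mul_assoc, inv_mul_cancel_right₀ (hyk k)]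
    exact smul_right_injective D hρk this
  obtain ⟨c, hc⟩ := exists_eq_sum_pow hρ hD hx hy hyx hfx
  have ht : t = (∑ n, c n • x ^ (n : ℕ)) * y ^ k := by
    rw [hc, inv_mul_cancel_right₀ (hyk k)]
  have hf : ∑ n, c n • x ^ (n : ℕ) = aeval x (C (c 0) + C (c 1) * X + C (c 2) * X ^ 2 +
      C (c 3) * X ^ 3 + C (c 4) * X ^ 4) := by
    rw [Fin.sum_univ_five]
    simp [Algebra.smul_def]
  rw [hf] at ht
  have hc0 : c 0 = 0 := by
    rw [ht, words_eq hyx, wordPoly_four_one hρ hk] at h41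
    have h5 := five_ne_zero_of_isPrimitiveRoot hρ
    have h41' : aeval x (C (5 * c 0) * X ^ 0) * y ^ (4 + k * 1) = 0 := by
      simpa only [map_mul, map_ofNat, pow_zero, mul_one] using h41
    exact (mul_eq_zero.mp (aeval_C_mul_X_pow_mul_eq_zero hx0 (hyk _) h41')).resolve_left h5
  rw [hc0, C_0, zero_add] at ht
  have hc4 : c 4 = 0 := by
    obtain ⟨γ, hγ, h⟩ := exists_markedWordPoly_three_one hρ hk
    rw [ht, markedWords_eq hyx, h] at h31
    exact (mul_eq_zero.mp (aeval_C_mul_X_pow_mul_eq_zero hx0 (hyk _) h31)).resolve_left hγ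
  rw [hc4, C_0, zero_mul, add_zero] at ht
  have hc23 : c 2 * c 3 = 0 := by
    obtain ⟨γ, hγ, h⟩ := exists_wordPoly_three_two hρ hk
    rw [ht, words_eq hyx, h] at h32
    exact (mul_eq_zero.mp (aeval_C_mul_X_pow_mul_eq_zero hx0 (hyk _) h32)).resolve_left hγ
  -- With `c 2 * c 3 = 0` this last equation reads `γ c₁ c₃ + δ c₂ ^ 2 = 0`, leaving only `c₁ X` or
  -- `c₃ X ^ 3` for `f`.
  obtain ⟨γ, δ, ε, hγ, hδ, h⟩ := exists_markedWordPoly_two_two hρ hk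
  rw [ht, markedWords_eq hyx, h, hc23, mul_zero, C_0, zero_mul, add_zero] at h22
  have h22' := aeval_C_mul_X_pow_mul_eq_zero hx0 (hyk _) h22
  have hmono (n : ℕ) (a : F) (hn : t = aeval x (C a * X ^ n) * y ^ k) :
      ∃ ω : F, ω ^ 5 = 1 ∧ t * y = ω • (y * t) := by
    rw [hn, map_mul, map_pow, aeval_C, aeval_X, ← Algebra.smul_def]
    exact exists_mul_eq_smul_monomial hρ.pow_eq_one hyx a n k
  rcases mul_eq_zero.mp hc23 with h2 | h3
  · have h13 : c 1 * c 3 = 0 := by simpa [h2, hγ] using h22'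
    rcases mul_eq_zero.mp h13 with h1 | h3
    · exact hmono 3 (c 3) (by rw [ht, h1, h2]; simp)
    · exact hmono 1 (c 1) (by rw [ht, h3, h2]; simp)
  · have h2 : c 2 = 0 := by simpa [h3, hδ] using h22'
    exact hmono 1 (c 1) (by rw [ht, h3, h2]; simp)

theorem reflTransGen_adj_of_graded {ρ : F} (hρ : IsPrimitiveRoot ρ 5)
    (hD : Module.finrank F D = 25) {x y t : D} (hx : IsVertex F 5 x)
    (hz : IsVertex F 5 (y + t))
    (hQ : ∑ j ∈ Finset.range 5, (y + t) ^ j * x * (y + t) ^ (4 - j) = 0) (hy : y ≠ 0)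
    (ht : t ≠ 0) {k : ℕ} (hk : k = 0 ∨ k = 2 ∨ k = 4) {i : ZMod 5} (hi : i ≠ 0)
    (hyx : y ∈ graded ρ x i) (htx : t ∈ graded ρ x (k * i)) :
    Relation.ReflTransGen (Adj F) x (y + t) := by
  have h5 : (ρ ^ i.val) ^ 5 = 1 := by
    rw [← pow_mul, mul_comm, pow_mul, hρ.pow_eq_one, one_pow]
  have hρ' : IsPrimitiveRoot (ρ ^ i.val) 5 := isPrimitiveRoot_of_pow_eq_one h5
    (hρ.pow_ne_one_of_pos_of_lt (by simpa using hi) (ZMod.val_lt i))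
  rw [mem_graded] at hyx htx
  have hki : ρ ^ ((k : ZMod 5) * i).val = (ρ ^ i.val) ^ k := by
    rw [← pow_mul, mul_comm i.val, ← pow_val_natCast hρ.pow_eq_one (k * i.val)]
    simp
  rw [hki] at htx
  have hne : ρ ^ i.val ≠ (ρ ^ i.val) ^ k := by
    intro h
    have := hρ'.pow_inj (i := 1) (j := k) (by norm_num) (by omega) (by rwa [pow_one])
    omega
  obtain ⟨ω, hω, hty⟩ : ∃ ω : F, ω ^ 5 = 1 ∧ t * y = ω • (y * t) := by
    rcases hk with rfl | hk
    · exact exists_mul_eq_smul_of_commute hρ' hD hx hz.1.2.1 hy ht hyx (by simpa using htx)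
    · exact exists_mul_eq_smul hρ' hD hx hz.1.2.1 hQ hy hk hyx htx
  exact reflTransGen_adj_add hD hx hz hy ht h5
    (by rw [← pow_mul, mul_comm, pow_mul, h5, one_pow]) hne hω hyx htx hty

theorem reflTransGen_adj_of_divisionRing {ρ : F} (hρ : IsPrimitiveRoot ρ 5)
    (hD : Module.finrank F D = 25) {x z : D} (hx : IsVertex F 5 x) (hz : IsVertex F 5 z)
    (hw : weight 5 ρ x z = 2) (h0 : (0 : ZMod 5) ∉ label 5 ρ z x) :
    Relation.ReflTransGen (Adj F) x z := by
  have hQ := sum_pow_mul_pow_eq_zero hρ hz h0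
  obtain ⟨c, hc, -⟩ := existsUnique_isDecomposition 5 hρ hx z
  rw [weight, label_eq hρ hx hc, Set.ncard_eq_two] at hw
  obtain ⟨i, j, hij, hset⟩ := hw
  have hmem (l : ZMod 5) : c l ≠ 0 ↔ l = i ∨ l = j := by
    simpa using Set.ext_iff.mp hset l
  have hzc : z = c i + c j := by
    rw [← hc.2]
    refine Fintype.sum_eq_add i j hij fun l hl => ?_
    by_contra h
    have := (hmem l).mp h
    tauto
  have hi := (hmem i).mpr (.inl rfl)
  have hj := (hmem j).mpr (.inr rfl)
  -- Swapping the components inverts the ratio of degrees, so ratio 3 becomes 2 and an infinite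
  -- ratio becomes 0.
  have hdec : ∀ i j : ZMod 5, i ≠ j → ∃ k : ℕ, (k = 0 ∨ k = 2 ∨ k = 4) ∧
      ((i ≠ 0 ∧ j = k * i) ∨ (j ≠ 0 ∧ i = k * j)) := by
    intro i j h
    suffices ∃ k ∈ ({0, 2, 4} : Finset ℕ), (i ≠ 0 ∧ j = k * i) ∨ (j ≠ 0 ∧ i = k * j) by
      obtain ⟨k, hk, h⟩ := this
      simp only [Finset.mem_insert, Finset.mem_singleton] at hk
      exact ⟨k, hk, h⟩
    revert i j; decide
  obtain ⟨k, hk, ⟨hi0, hjk⟩ | ⟨hj0, hik⟩⟩ := hdec i j hij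
  · rw [hzc] at hz hQ ⊢
    exact reflTransGen_adj_of_graded hρ hD hx hz hQ hi hj hk hi0 (hc.1 i)
      (by rw [← hjk]; exact hc.1 j)
  · rw [hzc, add_comm] at hz hQ ⊢
    exact reflTransGen_adj_of_graded hρ hD hx hz hQ hj hi hk hj0 (hc.1 j)
      (by rw [← hik]; exact hc.1 i)

end Division

/-! ### The split algebra: connecting through dilations -/

section Split

open Polynomial

variable {F V : Type*} [Field F] [AddCommGroup V] [Module F V]

/-- The endomorphism that is `ρ` on `v` and the identity on the kernel of `φ`, when `φ v = 1`. -/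
def dilation (ρ : F) (v : V) (φ : Module.Dual F V) : Module.End F V :=
  1 + (ρ - 1) • φ.smulRight v

theorem dilation_apply (ρ : F) (v : V) (φ : Module.Dual F V) (w : V) :
    dilation ρ v φ w = w + ((ρ - 1) * φ w) • v := by
  simp [dilation, smul_smul]

theorem dilation_pow (ρ : F) {v : V} {φ : Module.Dual F V} (h : φ v = 1) (n : ℕ) :
    dilation ρ v φ ^ n = dilation (ρ ^ n) v φ := by
  induction n with
  | zero => simp [dilation]
  | succ n ih =>
    ext w
    rw [pow_succ, ih, Module.End.mul_apply]
    simp only [dilation_apply, map_add, map_smul, h]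
    module

theorem isVertex_dilation {ρ : F} (hρ : IsPrimitiveRoot ρ 5) (hV : Module.finrank F V = 5) {v : V}
    {φ : Module.Dual F V} (h : φ v = 1) : IsVertex F 5 (dilation ρ v φ) := by
  have : Module.Finite F V := Module.finite_of_finrank_pos (by omega)
  have h5 : dilation ρ v φ ^ 5 = 1 := by
    rw [dilation_pow ρ h, hρ.pow_eq_one]
    simp [dilation]
  refine isVertex_of_pow (.of_pow_eq_one h5 (by norm_num)) (by rw [h5]; exact one_mem _) fun hc => ?_
  -- The rank-one map sending `v` to `u` in `ker φ` does not commute with the dilation, as `ρ ≠ 1`.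
  obtain ⟨u, hu, hu0⟩ : ∃ u ∈ LinearMap.ker φ, u ≠ 0 := by
    refine Submodule.exists_mem_ne_zero_of_ne_bot (LinearMap.ker_ne_bot_of_finrank_lt ?_)
    rw [hV, Module.finrank_self]
    norm_num
  have := LinearMap.congr_fun (Subalgebra.mem_center_iff.mp hc (φ.smulRight u)) v
  simp only [Module.End.mul_apply, dilation_apply, LinearMap.smulRight_apply, map_add, map_smul, h,
    LinearMap.mem_ker.mp hu] at this
  have h1 : (ρ - 1) • u = 0 := by
    have h2 : u + (ρ - 1) • u = u := by simpa [add_smul] using this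
    simpa using h2
  rcases smul_eq_zero.mp h1 with h1 | h1
  · exact hρ.ne_one (by norm_num) (sub_eq_zero.mp h1)
  · exact hu0 h1

theorem adj_dilation {ρ : F} (hρ : IsPrimitiveRoot ρ 5) (hV : Module.finrank F V = 5) {v v' : V}
    {φ φ' : Module.Dual F V} (h : φ v = 1) (h' : φ' v' = 1) (h₁ : φ v' = 0) (h₂ : φ' v = 0) :
    Adj F (dilation ρ v φ) (dilation ρ v' φ') := by
  refine ⟨isVertex_dilation hρ hV h, isVertex_dilation hρ hV h', .of_commute ?_⟩
  ext w
  simp only [Module.End.mul_apply, dilation_apply, map_add, map_smul, h₁, h₂]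
  module

/-- The common kernel of `φ` and `φ'` has dimension at least 3, so it contains some `w` outside the
span of `v` and `v'`. A functional killing `v` and `v'` but not `w` gives a dilation along `w`
commuting with both. -/
theorem reflTransGen_adj_dilation {ρ : F} (hρ : IsPrimitiveRoot ρ 5)
    (hV : Module.finrank F V = 5) {v v' : V} {φ φ' : Module.Dual F V} (h : φ v = 1)
    (h' : φ' v' = 1) :
    Relation.ReflTransGen (Adj F) (dilation ρ v φ) (dilation ρ v' φ') := by
  have : Module.Finite F V := Module.finite_of_finrank_pos (by omega)
  have hnle : ¬ LinearMap.ker (φ.prod φ') ≤ Submodule.span F {v, v'} := by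
    intro hle
    have h1 := Submodule.finrank_mono hle
    have h2 := LinearMap.finrank_range_add_finrank_ker (φ.prod φ')
    have h3 := Submodule.finrank_le (LinearMap.range (φ.prod φ'))
    rw [Module.finrank_prod, Module.finrank_self] at h3
    classical
    have h4 : Module.finrank F (Submodule.span F {v, v'}) ≤ 2 := by
      have h5 := finrank_span_finset_le_card (R := F) ({v, v'} : Finset V)
      rw [Finset.coe_pair] at h5
      exact h5.trans Finset.card_le_two
    omega
  obtain ⟨w, hw, hwS⟩ := SetLike.not_le_iff_exists.mp hnle
  obtain ⟨f, hfw, hf⟩ := Submodule.exists_le_ker_of_notMem hwS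
  have hfv : f v = 0 := hf (Submodule.subset_span (by simp))
  have hfv' : f v' = 0 := hf (Submodule.subset_span (by simp))
  simp only [LinearMap.ker_prod, Submodule.mem_inf, LinearMap.mem_ker] at hw
  have hw1 : ((f w)⁻¹ • f) w = 1 := by simp [hfw]
  exact .tail (.single (adj_dilation hρ hV h hw1 hw.1 (by simp [hfv])))
    (adj_dilation hρ hV hw1 h' (by simp [hfv']) hw.2)

theorem pow_apply_of_eigen {x : Module.End F V} {v : V} {a : F} (hv : x v = a • v) (n : ℕ) :
    (x ^ n) v = a ^ n • v := by
  induction n with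
  | zero => simp
  | succ n ih => rw [pow_succ, Module.End.mul_apply, hv, map_smul, ih, smul_smul, pow_succ']

/-- Central endomorphisms are scalar. -/
theorem exists_apply_eq_smul_of_mem_center {c : Module.End F V}
    (hc : c ∈ Subalgebra.center F (Module.End F V)) : ∃ α : F, ∀ w, c w = α • w := by
  rcases subsingleton_or_nontrivial V with _ | _
  · exact ⟨0, fun w => Subsingleton.elim _ _⟩
  obtain ⟨v, hv⟩ := exists_ne (0 : V)
  obtain ⟨ψ, hψ⟩ := Module.Projective.exists_dual_ne_zero F hv
  refine ⟨(ψ v)⁻¹ * ψ (c v), fun w => ?_⟩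
  have h := LinearMap.congr_fun (Subalgebra.mem_center_iff.mp hc (ψ.smulRight w)) v
  simp only [Module.End.mul_apply, LinearMap.smulRight_apply, map_smul] at h
  rw [mul_smul, h, inv_smul_smul₀ hψ]

theorem exists_adj_dilation_of_eigen {ρ : F} (hρ : IsPrimitiveRoot ρ 5)
    (hV : Module.finrank F V = 5) {x : Module.End F V} (hx : IsVertex F 5 x) {v : V} (hv0 : v ≠ 0)
    {a : F} (hv : x v = a • v) :
    ∃ (u : V) (φ : Module.Dual F V), φ u = 1 ∧ Adj F x (dilation ρ u φ) := by
  obtain ⟨ψ, hψ⟩ := Module.Projective.exists_dual_ne_zero F hv0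
  have h5 : (5 : F) ≠ 0 := five_ne_zero_of_isPrimitiveRoot hρ
  obtain ⟨α, hx5⟩ := exists_apply_eq_smul_of_mem_center hx.1.2.1
  obtain rfl : α = a ^ 5 := by
    apply smul_left_injective F hv0
    simp only
    rw [← hx5, pow_apply_of_eigen hv]
  have ha : a ≠ 0 := by
    rintro rfl
    have hinj := ((Module.End.isUnit_iff x).mp hx.2).injective
    exact hv0 (hinj (by rw [hv, zero_smul, map_zero]))
  -- Averaging `ψ` over the powers of `a⁻¹ x`, whose fifth power is 1, gives a left eigenvector of
  -- `x` with eigenvalue `a`; the scalar normalizes `φ v = 1`.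
  let φ : Module.Dual F V :=
    (5 * ψ v)⁻¹ • ∑ j ∈ Finset.range 5, a⁻¹ ^ j • ψ ∘ₗ (x ^ j)
  have hφv : φ v = 1 := by
    simp only [φ, LinearMap.smul_apply, LinearMap.sum_apply, LinearMap.comp_apply,
      pow_apply_of_eigen hv, map_smul, smul_eq_mul]
    have : ∀ j ∈ Finset.range 5, a⁻¹ ^ j * (a ^ j * ψ v) = ψ v := fun j _ => by
      rw [← mul_assoc, ← mul_pow, inv_mul_cancel₀ ha, one_pow, one_mul]
    rw [Finset.sum_congr rfl this]
    simp only [Finset.sum_const, Finset.card_range, nsmul_eq_mul]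
    exact inv_mul_cancel₀ (mul_ne_zero h5 hψ)
  have hφx (w : V) : φ (x w) = a * φ w := by
    simp only [φ, LinearMap.smul_apply, LinearMap.sum_apply, LinearMap.comp_apply, smul_eq_mul]
    rw [mul_left_comm]
    congr 1
    rw [Finset.mul_sum]
    let g (j : ℕ) : F := a * (a⁻¹ ^ j * ψ ((x ^ j) w))
    have hg (j : ℕ) : a⁻¹ ^ j * ψ ((x ^ j) (x w)) = g (j + 1) := by
      simp only [g]
      rw [pow_succ x, Module.End.mul_apply, pow_succ', ← mul_assoc, ← mul_assoc,
        mul_inv_cancel₀ ha, one_mul]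
    have hg5 : g 5 = g 0 := by
      simp only [g, hx5, map_smul, smul_eq_mul, inv_pow, pow_zero, Module.End.one_apply]
      rw [inv_mul_cancel_left₀ (pow_ne_zero _ ha)]
      simp
    rw [Finset.sum_congr rfl fun j _ => hg j]
    have h1 := Finset.sum_range_succ g 5
    rw [Finset.sum_range_succ' g 5, hg5] at h1
    exact add_right_cancel h1
  refine ⟨v, φ, hφv, hx, isVertex_dilation hρ hV hφv, .of_commute ?_⟩
  ext w
  simp only [Module.End.mul_apply, dilation_apply, map_add, map_smul, hv, hφx]
  module

theorem linearIndependent_pow_apply {x : Module.End F V} {α : F}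
    (hx : ∀ w, (x ^ 5) w = α • w) (hirr : Irreducible (X ^ 5 - C α : F[X])) {v : V} (hv : v ≠ 0) :
    LinearIndependent F (fun n : Fin 5 => (x ^ (n : ℕ)) v) := by
  rw [Fintype.linearIndependent_iff]
  intro c hc
  let q : F[X] := ∑ n : Fin 5, C (c n) * X ^ (n : ℕ)
  have hqv : aeval x q v = 0 := by
    simpa [q, ← Algebra.smul_def] using hc
  have hpv : aeval x (X ^ 5 - C α : F[X]) = 0 := by
    ext w
    simp [hx]
  have hq : q = 0 := by
    by_contra hq
    have hdeg : q.degree < (X ^ 5 - C α : F[X]).degree := by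
      rw [degree_X_pow_sub_C (by norm_num)]
      refine (degree_sum_le _ _).trans_lt ((Finset.sup_lt_iff (WithBot.bot_lt_coe 5)).mpr fun n _ => ?_)
      exact (degree_C_mul_X_pow_le _ _).trans_lt (by exact_mod_cast n.2)
    -- A nonzero relation `q` of degree below 5 is coprime to the irreducible `X ^ 5 - α`; Bézout
    -- applied to `v` then gives `v = 0`.
    have hcop : IsCoprime (X ^ 5 - C α : F[X]) q :=
      (hirr.coprime_iff_not_dvd).mpr fun hd => hq (eq_zero_of_dvd_of_degree_lt hd hdeg)
    obtain ⟨s, t, hst⟩ := hcop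
    have := congrArg (fun p => aeval x p v) hst
    simp [hpv, hqv] at this
    exact hv this.symm
  intro n
  have := congrArg (fun p => coeff p (n : ℕ)) hq
  simpa [q, finsetSum_coeff, coeff_C_mul, coeff_X_pow, ← Fin.ext_iff] using this

theorem exists_eigen_of_pow_eq {ρ : F} (hρ : IsPrimitiveRoot ρ 5) (hV : Module.finrank F V = 5)
    {x : Module.End F V} {b : F} (hx : ∀ w, (x ^ 5) w = b ^ 5 • w) :
    ∃ (v : V) (a : F), v ≠ 0 ∧ x v = a • v := by
  have : Module.Finite F V := Module.finite_of_finrank_pos (by omega)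
  have : Nontrivial V := Module.nontrivial_of_finrank_pos (R := F) (by omega)
  have hp : aeval x (X ^ 5 - C (b ^ 5) : F[X]) = 0 := by
    ext w
    rw [map_sub, map_pow, aeval_X, aeval_C, LinearMap.sub_apply, hx, Module.algebraMap_end_apply,
      sub_self, LinearMap.zero_apply]
  have hs : (minpoly F x).Splits :=
    (X_pow_sub_C_splits_of_isPrimitiveRoot hρ rfl).of_dvd (X_pow_sub_C_ne_zero (by norm_num) _)
      (minpoly.dvd F x hp)
  obtain ⟨a, ha⟩ := hs.exists_eval_eq_zero (minpoly.degree_pos (Algebra.IsIntegral.isIntegral x)).ne'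
  obtain ⟨v, hv⟩ := (Module.End.hasEigenvalue_of_isRoot ha).exists_hasEigenvector
  exact ⟨v, a, hv.2, hv.apply_eq_smul⟩

/-- A vertex without eigenvector is connected to a vertex with an eigenvector. -/
theorem exists_adj_of_irreducible {ρ : F} (hρ : IsPrimitiveRoot ρ 5)
    (hV : Module.finrank F V = 5) {x : Module.End F V} (hxv : IsVertex F 5 x) {α : F}
    (hx : ∀ w, (x ^ 5) w = α • w) (hirr : Irreducible (X ^ 5 - C α : F[X])) :
    ∃ (y : Module.End F V) (v : V), Adj F x y ∧ v ≠ 0 ∧ y v = (1 : F) • v := by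
  have : Nontrivial V := Module.nontrivial_of_finrank_pos (R := F) (by omega)
  obtain ⟨v, hv⟩ := exists_ne (0 : V)
  have hli := linearIndependent_pow_apply hx hirr hv
  let b := basisOfLinearIndependentOfCardEqFinrank hli (by rw [hV, Fintype.card_fin])
  have hb (n : Fin 5) : b n = (x ^ (n : ℕ)) v := by simp [b]
  let y : Module.End F V := b.constr F fun n => ρ ^ (n : ℕ) • b n
  have hyb (n : Fin 5) : y (b n) = ρ ^ (n : ℕ) • b n := b.constr_basis F _ n
  have hyv : y v = (1 : F) • v := by simpa [hb] using hyb 0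
  -- The case `n = 5` closes the cycle: `x ^ 5 v = α v`, and `ρ ^ 5 = 1`.
  have hyn (n : ℕ) (hn : n ≤ 5) : y ((x ^ n) v) = ρ ^ n • (x ^ n) v := by
    rcases hn.lt_or_eq with hn | rfl
    · simpa [hb] using hyb ⟨n, hn⟩
    · rw [hx, map_smul, hyv, hρ.pow_eq_one, smul_comm]
  have hyx : y * x = ρ • (x * y) := by
    refine b.ext fun n => ?_
    have h1 : x (b n) = (x ^ (n + 1 : ℕ)) v := by rw [hb, pow_succ', Module.End.mul_apply]
    rw [Module.End.mul_apply, LinearMap.smul_apply, Module.End.mul_apply, hyb, map_smul, h1,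
      hyn _ (by omega), smul_smul, pow_succ']
  have hy5 : y ^ 5 = 1 := by
    refine b.ext fun n => ?_
    rw [pow_apply_of_eigen (hyb n), ← pow_mul, mul_comm, pow_mul, hρ.pow_eq_one, one_pow, one_smul,
      Module.End.one_apply]
  have hyu : IsUnit y := .of_pow_eq_one hy5 (by norm_num)
  refine ⟨y, v, ⟨hxv, ?_, ρ, hρ.pow_eq_one, hyx⟩, hv, hyv⟩
  refine isVertex_of_pow hyu (by rw [hy5]; exact one_mem _) fun hc => ?_
  rw [Subalgebra.mem_center_iff] at hc
  have h1 : (1 - ρ) • (x * y) = 0 := by rw [sub_smul, ← hyx, hc x, one_smul, sub_self]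
  rw [smul_eq_zero, sub_eq_zero] at h1
  rcases h1 with h1 | h1
  · exact hρ.ne_one (by norm_num) h1.symm
  · exact (hxv.2.mul hyu).ne_zero h1

/-- If `x ^ 5` is a fifth power in `F`, then `x` has an eigenvector and commutes with a dilation.
Otherwise `X ^ 5 - α` is irreducible, and `x` is adjacent to a vertex fixing a nonzero vector. -/
theorem exists_reflTransGen_dilation {ρ : F} (hρ : IsPrimitiveRoot ρ 5)
    (hV : Module.finrank F V = 5) {x : Module.End F V} (hx : IsVertex F 5 x) :
    ∃ (u : V) (φ : Module.Dual F V), φ u = 1 ∧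
      Relation.ReflTransGen (Adj F) x (dilation ρ u φ) := by
  obtain ⟨α, hα⟩ := exists_apply_eq_smul_of_mem_center hx.1.2.1
  by_cases hb : ∃ b : F, b ^ 5 = α
  · obtain ⟨b, rfl⟩ := hb
    obtain ⟨v, a, hv0, hv⟩ := exists_eigen_of_pow_eq hρ hV hα
    obtain ⟨u, φ, h, hadj⟩ := exists_adj_dilation_of_eigen hρ hV hx hv0 hv
    exact ⟨u, φ, h, .single hadj⟩
  · push Not at hb
    obtain ⟨y, v, hxy, hv0, hv⟩ := exists_adj_of_irreducible hρ hV hx hα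
      (X_pow_sub_C_irreducible_of_prime (by norm_num) hb)
    obtain ⟨u, φ, h, hadj⟩ := exists_adj_dilation_of_eigen hρ hV hxy.2.1 hv0 hv
    exact ⟨u, φ, h, .tail (.single hxy) hadj⟩

theorem reflTransGen_adj_end {ρ : F} (hρ : IsPrimitiveRoot ρ 5) (hV : Module.finrank F V = 5)
    {x z : Module.End F V} (hx : IsVertex F 5 x) (hz : IsVertex F 5 z) :
    Relation.ReflTransGen (Adj F) x z := by
  obtain ⟨u, φ, h, hxu⟩ := exists_reflTransGen_dilation hρ hV hx
  obtain ⟨u', φ', h', hzu⟩ := exists_reflTransGen_dilation hρ hV hz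
  exact (hxu.trans (reflTransGen_adj_dilation hρ hV h h')).trans
    (Relation.ReflTransGen.mono (fun _ _ h => h.symm) _ _ hzu.swap)

end Split

/-! ### The dichotomy between split and division algebras -/

theorem adj_reflTransGen_of_algEquiv {F A B : Type*} [Field F] [Ring A] [Algebra F A] [Ring B]
    [Algebra F B] (e : A ≃ₐ[F] B) {x z : A} (h : Relation.ReflTransGen (Adj F) (e x) (e z)) :
    Relation.ReflTransGen (Adj F) x z := by
  have := h.lift e.symm fun _ _ h => h.map e.symm
  simpa [Function.onFun] using this

/-- A central simple algebra of degree `5` is split or a division algebra. -/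
theorem isUnit_or_eq_zero_or_split {F A : Type*} [Field F] [Ring A] [Algebra F A] [IsSimpleRing A]
    (hA : Module.finrank F A = 25) :
    (∀ a : A, IsUnit a ∨ a = 0) ∨ Nonempty (A ≃ₐ[F] Module.End F (Fin 5 → F)) := by
  have : Module.Finite F A := Module.finite_of_finrank_pos (by omega)
  have : IsArtinianRing A := IsArtinianRing.of_finite F A
  obtain ⟨n, hn, D, _, _, _, ⟨e⟩⟩ :=
    IsSimpleRing.exists_algEquiv_matrix_divisionRing_finite F A
  have hdim := e.toLinearEquiv.finrank_eq
  rw [hA, Module.finrank_matrix, Fintype.card_fin] at hdim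
  have hn5 : n = 1 ∨ n = 5 := by
    have h1 : n ∣ 25 := ⟨n * Module.finrank F D, by rw [hdim, mul_assoc]⟩
    have h2 : n ≤ 25 := Nat.le_of_dvd (by norm_num) h1
    have h3 : n * n ∣ 25 := ⟨Module.finrank F D, hdim⟩
    interval_cases n <;> revert h3 <;> decide
  rcases hn5 with rfl | rfl
  · left
    intro a
    rcases eq_or_ne (e a 0 0) 0 with h | h
    · right
      apply e.injective
      ext i j
      simpa [Subsingleton.elim i 0, Subsingleton.elim j 0] using h
    · left
      have hu : IsUnit (e a) := by
        refine ⟨⟨e a, .of fun _ _ => (e a 0 0)⁻¹, ?_, ?_⟩, rfl⟩ <;>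
        · ext i j
          obtain rfl : i = 0 := Subsingleton.elim _ _
          obtain rfl : j = 0 := Subsingleton.elim _ _
          simp [Matrix.mul_apply, h]
      simpa using hu.map e.symm
  · right
    have hD : Module.finrank F D = 1 := by omega
    let e' : F ≃ₐ[F] D := AlgEquiv.ofBijective (Algebra.ofId F D)
      (Module.Free.bijective_algebraMap_of_finrank_eq_one hD)
    exact ⟨(e.trans e'.symm.mapMatrix).trans Matrix.toLinAlgEquiv'⟩

end RostChains

theorem mainTheorem8 {F : Type*} [Field F] {ρ : F} (hρ : IsPrimitiveRoot ρ 5)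
    {A : Type*} [Ring A] [Algebra F A] (hA : RostChains.IsCyclicAlgebra 5 ρ A)
    (x z : A) (hx : RostChains.IsVertex F 5 x) (hz : RostChains.IsVertex F 5 z)
    (hw : RostChains.weight 5 ρ x z = 2) (h0 : (0 : ZMod 5) ∉ RostChains.label 5 ρ z x) :
    RostChains.RostConnected 5 ρ x z := by
  obtain ⟨-, hsimple, hdim, -⟩ := hA
  have hdim : Module.finrank F A = 25 := hdim
  refine RostChains.rostConnected_of_reflTransGen hρ hx ?_
  rcases RostChains.isUnit_or_eq_zero_or_split hdim with h | ⟨⟨e⟩⟩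
  · let : DivisionRing A := DivisionRing.ofIsUnitOrEqZero h
    exact RostChains.reflTransGen_adj_of_divisionRing hρ hdim hx hz hw h0
  · exact RostChains.adj_reflTransGen_of_algEquiv e
      (RostChains.reflTransGen_adj_end hρ (by simp) (hx.map e) (hz.map e))
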